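/- Let $n \ge k \ge d \ge 1$ be integers and let $\mathbb{Q}[\mathbf{x}_n,\mathbf{y}_d,\mathbf{t}_k]$ be the polynomial ring in the variables $x_1,\dots,x_n$, $y_1,\dots,y_d$, $t_1,\dots,t_k$, regarded as the coordinate ring of $\mathbb{Q}^{n+d+k}$. Let $\mathcal{Z}_{n,k,d} \subseteq \mathbb{Q}^{n+d+k}$ be the set of points $(x_1,\dots,x_n;y_1,\dots,y_d;t_1,\dots,t_k)$ for which there are an injection $f:\{1,\dots,d\}\hookrightarrow\{1,\dots,k\}$ with $y_i=t_{f(i)}$ for all $i$ and a surjection $g:\{1,\dots,n\}\twoheadrightarrow\{1,\dots,d\}$ with $x_j=y_{g(j)}$ for all $j$. Let $\mathbf{I}(\mathcal{Z}_{n,k,d})$ be the ideal of all polynomials vanishing on $\mathcal{Z}_{n,k,d}$. Write $e_r$ and $h_r$ for the elementary and the complete homogeneous symmetric polynomials, with $e_0=h_0=1$ and $e_r = 0$ when $r$ exceeds the number of variables. Let $J^{\mathbb{Q},\mathbf{t}}_{n,k,d} \subseteq \mathbb{Q}[\mathbf{x}_n,\mathbf{y}_d,\mathbf{t}_k]$ be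 the ideal generated by - $\sum_{j=0}^r (-1)^j e_{r-j}(\mathbf{t}_k)\,h_j(\mathbf{y}_d)$ for all $r>k-d$, - $\sum_{j=0}^r (-1)^j e_{r-j}(\mathbf{x}_n)\,h_j(\mathbf{y}_d)$ for all $r>n-d$, and - $\sum_{j=0}^d (-1)^j x_i^{d-j}\,e_j(\mathbf{y}_d)$ for $i=1,\dots,n$. An $(n,d)$-staircase is a shuffle (an interleaving that keeps the order of each sequence) of $(0,1,\dots,d-1)$ with the sequence $(d-1,\dots,d-1)$ of length $n-d$, and a sequence $(a_1,\dots,a_n)$ of nonnegative integers is $(n,d)$-substaircase if it is componentwise $\le$ some $(n,d)$-staircase. Let $\mathcal{A}_{n,k,d}$ be the set of monomials $x_1^{a_1}\cdots x_n^{a_n}\,y_1^{b_1}\cdots y_d^{b_d}$ such that $(a_1,\dots,a_n)$ is $(n,d)$-substaircase and $0\le b_i<k-d+i$ for $i=1,\dots,d$, and let $\mathcal{A}^{\mathbf{t}}_{n,k,d}$ be the set of products $m\cdot t_1^{c_1}\cdots t_k^{c_k}$ with $m\in\mathcal{A}_{n,k,d}$ and $c_1,\dots,c_k\ge 0$. **Proposition.**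 We have the equality of ideals $J^{\mathbb{Q},\mathbf{t}}_{n,k,d}=\mathbf{I}(\mathcal{Z}_{n,k,d})$. The set $\mathcal{A}^{\mathbf{t}}_{n,k,d}$ descends to a $\mathbb{Q}$-basis of the quotient ring $\mathbb{Q}[\mathbf{x}_n,\mathbf{y}_d,\mathbf{t}_k]/J^{\mathbb{Q},\mathbf{t}}_{n,k,d}=\mathbb{Q}[\mathbf{x}_n,\mathbf{y}_d,\mathbf{t}_k]/\mathbf{I}(\mathcal{Z}_{n,k,d})$. In particular, this quotient is a free $\mathbb{Q}[\mathbf{t}_k]$-module of finite rank $$\frac{k!\cdot d!}{(k-d)!}\cdot\mathrm{Stir}(n,d),$$ where $\mathrm{Stir}(n,d)$ is the Stirling number of the second kind, the number of partitions of $\{1,\dots,n\}$ into $d$ nonempty blocks. -/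

import Mathlib

noncomputable section

namespace OrbitHarmonics

open MvPolynomial

/-- Index set of the coordinates of `ℚ ^ (n + d + k)`, in three blocks: `n` coordinates `x`,
`d` coordinates `y` and `k` coordinates `t`. -/
abbrev Idx (n k d : ℕ) : Type := Fin n ⊕ Fin d ⊕ Fin k

/-- The polynomial ring `ℚ[x₁,…,xₙ, y₁,…,y_d, t₁,…,t_k]`. -/
abbrev PolyXYT (n k d : ℕ) : Type := MvPolynomial (Idx n k d) ℚ

/-- The position of the coordinate `x_i`. -/
abbrev ix {n k d : ℕ} (i : Fin n) : Idx n k d := Sum.inl i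

/-- The position of the coordinate `y_i`. -/
abbrev iy {n k d : ℕ} (i : Fin d) : Idx n k d := Sum.inr (Sum.inl i)

/-- The position of the coordinate `t_i`. -/
abbrev it {n k d : ℕ} (i : Fin k) : Idx n k d := Sum.inr (Sum.inr i)

/-- The ring `ℚ[x,y,t]` as an algebra over `ℚ[t₁,…,t_k]`, through the inclusion of the
`t`-variables. Quotients of `ℚ[x,y,t]` by ideals inherit this structure. -/
instance tAlgebra (n k d : ℕ) : Algebra (MvPolynomial (Fin k) ℚ) (PolyXYT n k d) :=
  (rename (it : Fin k → Idx n k d) :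
    MvPolynomial (Fin k) ℚ →ₐ[ℚ] PolyXYT n k d).toRingHom.toAlgebra

/-- The infinite locus in `ℚ ^ (n + d + k)`: the `y`-coordinates are the `t`-coordinates
at `d` distinct positions, and the `x`-coordinates are the `y`-coordinates, with every
position in the `y`-block used. -/
def locus (n k d : ℕ) : Set (Idx n k d → ℚ) :=
  {z | (∃ f : Fin d → Fin k, Function.Injective f ∧ ∀ i, z (iy i) = z (it (f i))) ∧
    ∃ g : Fin n → Fin d, Function.Surjective g ∧ ∀ j, z (ix j) = z (iy (g j))}

/-- `e_r(x₁,…,xₙ)` in `ℚ[x,y,t]`. -/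
def eX (n k d r : ℕ) : PolyXYT n k d := rename ix (esymm (Fin n) ℚ r)

/-- `e_r(y₁,…,y_d)` in `ℚ[x,y,t]`. -/
def eY (n k d r : ℕ) : PolyXYT n k d := rename iy (esymm (Fin d) ℚ r)

/-- `e_r(t₁,…,t_k)` in `ℚ[x,y,t]`. -/
def eT (n k d r : ℕ) : PolyXYT n k d := rename it (esymm (Fin k) ℚ r)

/-- `h_r(y₁,…,y_d)` in `ℚ[x,y,t]`. -/
def hY (n k d r : ℕ) : PolyXYT n k d := rename iy (hsymm (Fin d) ℚ r)

/-- `e_r(t) - e_{r-1}(t) h_1(y) + ⋯ + (-1)^r h_r(y)`. -/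
def relT (n k d r : ℕ) : PolyXYT n k d :=
  ∑ j ∈ Finset.range (r + 1), (-1) ^ j * eT n k d (r - j) * hY n k d j

/-- `e_r(x) - e_{r-1}(x) h_1(y) + ⋯ + (-1)^r h_r(y)`. -/
def relX (n k d r : ℕ) : PolyXYT n k d :=
  ∑ j ∈ Finset.range (r + 1), (-1) ^ j * eX n k d (r - j) * hY n k d j

/-- `x_i^d - x_i^{d-1} e_1(y) + ⋯ + (-1)^d e_d(y)`. -/
def relPow (n k d : ℕ) (i : Fin n) : PolyXYT n k d :=
  ∑ j ∈ Finset.range (d + 1), (-1) ^ j * X (ix i) ^ (d - j) * eY n k d j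

/-- The ideal of `ℚ[x,y,t]` generated by the three families of relations. -/
def idealJ (n k d : ℕ) : Ideal (PolyXYT n k d) :=
  Ideal.span
    ({p | ∃ r, k - d < r ∧ p = relT n k d r} ∪
      {p | ∃ r, n - d < r ∧ p = relX n k d r} ∪
      {p | ∃ i : Fin n, p = relPow n k d i})

/-- `s` is an `(n,d)`-staircase: a shuffle of `(0, 1, …, d-1)` with `n - d` copies of `d - 1`.
The strictly increasing map `φ` records the positions of the entries of `(0, 1, …, d-1)`. -/
def IsStaircase {n : ℕ} (d : ℕ) (s : Fin n → ℕ) : Prop :=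
  ∃ φ : Fin d → Fin n, StrictMono φ ∧ (∀ i, s (φ i) = i) ∧ ∀ j ∉ Set.range φ, s j = d - 1

/-- `a` is `(n,d)`-substaircase: componentwise at most some `(n,d)`-staircase. -/
def IsSubstaircase {n : ℕ} (d : ℕ) (a : Fin n → ℕ) : Prop :=
  ∃ s : Fin n → ℕ, IsStaircase d s ∧ ∀ j, a j ≤ s j

/-- The monomials `x^a y^b` with `a` an `(n,d)`-substaircase sequence and `b_i < k - d + i` for
`i = 1, …, d` (the index `i : Fin d` starts at `0`). -/
def monomialsA (n k d : ℕ) : Set (PolyXYT n k d) :=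
  {m | ∃ (a : Fin n → ℕ) (b : Fin d → ℕ), IsSubstaircase d a ∧
    (∀ i : Fin d, b i < k - d + ((i : ℕ) + 1)) ∧
    m = (∏ j, X (ix j) ^ a j) * ∏ i, X (iy i) ^ b i}

/-- The products of the elements of `B` with all monomials in the `t`-variables. -/
def tAugment {n k d : ℕ} (B : Set (PolyXYT n k d)) : Set (PolyXYT n k d) :=
  {p | ∃ f ∈ B, ∃ c : Fin k → ℕ, p = f * ∏ i, X (it i) ^ c i}

end OrbitHarmonics

end

/-!
The two families of alternating sums are, up to sign, the coefficients above the expected degree of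
`∏ (1 - t_i z) / ∏ (1 - y_j z)` and `∏ (1 - x_i z) / ∏ (1 - y_j z)`. Hence in any commutative ring
they vanish if and only if `∏ (X - y_j)` divides `∏ (X - t_i)` and `∏ (X - x_i)`
(`forall_ehSum_eq_zero_iff`), while the remaining relations say that each `x_i` is a root of
`∏ (X - y_j)`. In this form the generators of `J` visibly vanish on the locus.

Divisibility also makes the monomials of `𝒜` span the quotient by `J` over `ℚ[t]`. For the
`y`-part one adjoins one root of `∏ (X - t_i)` at a time (`closure_monomials_flag_eq_top`). For the
`x`-part one proves the statement more generally for a pair of monic polynomials `Q ∣ P` such that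
the `x_i` are roots of `P` and `Q` divides `∏ (X - x_i)`, by induction on the number of variables:
for the last variable `z`, both the quotient by `Q(z)` and the ideal generated by `Q(z)` are
instances of the same problem with one variable less, and the two pieces correspond to the two ways
in which a subshuffle can end (`closure_monomials_isSubshuffle_eq_top`).

The locus is a union of linear subspaces, one for each pair `(f, g)` of an injection and a
surjection, and each is parametrized by its `t`-coordinates. So the quotient by the vanishing ideal
embeds into a product of copies of `ℚ[t]`, and over the fraction field of `ℚ[t]` its image is
everything, by Lagrange interpolation. The number of subspaces equals the number of elements of `𝒜`
(`ncard_isSubshuffle_self`, `card_surjective`). A spanning family whose size is the dimension is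
linearly independent; thus `𝒜` is a `ℚ[t]`-basis of the quotient by `J`, and the surjection onto the
quotient by the vanishing ideal is injective.
-/

noncomputable section

namespace OrbitHarmonics

/-! ### Sequences dominated by shuffles -/

/-- `a` is dominated by a shuffle of `(0, 1, …, s-1)` with a constant sequence `(d-1, …, d-1)`:
all entries are less than `d`, and some strictly increasing sequence of `s` positions carries
entries bounded by `0, 1, …, s-1`. -/
def IsSubshuffle {n : ℕ} (d s : ℕ) (a : Fin n → ℕ) : Prop :=
  (∀ j, a j < d) ∧ ∃ φ : Fin s → Fin n, StrictMono φ ∧ ∀ i, a (φ i) ≤ i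

theorem isSubstaircase_iff_isSubshuffle {n d : ℕ} (hd : 0 < d) (a : Fin n → ℕ) :
    IsSubstaircase d a ↔ IsSubshuffle d d a := by
  constructor
  · rintro ⟨s, ⟨φ, hφ, h1, h2⟩, has⟩
    refine ⟨fun j => ?_, φ, hφ, fun i => (has _).trans (h1 i).le⟩
    by_cases hj : j ∈ Set.range φ
    · obtain ⟨i, rfl⟩ := hj
      exact ((has _).trans (h1 i).le).trans_lt i.2
    · have := has j
      rw [h2 j hj] at this
      omega
  · rintro ⟨h, φ, hφ, h1⟩
    classical
    refine ⟨fun j => if hj : ∃ i, φ i = j then (hj.choose : ℕ) else d - 1, ⟨φ, hφ, ?_, ?_⟩, ?_⟩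
    · intro i
      have hj : ∃ i', φ i' = φ i := ⟨i, rfl⟩
      dsimp only
      rw [dif_pos hj]
      exact congrArg _ (hφ.injective hj.choose_spec)
    · intro j hj
      exact dif_neg hj
    · intro j
      dsimp only
      by_cases hj : ∃ i, φ i = j
      · rw [dif_pos hj]
        have := h1 hj.choose
        rwa [hj.choose_spec] at this
      · rw [dif_neg hj]
        have := h j
        omega

theorem IsSubshuffle.snoc {n d s : ℕ} {a : Fin n → ℕ} (ha : IsSubshuffle d s a) {v : ℕ}
    (hv : v < d) : IsSubshuffle d s (Fin.snoc a v : Fin (n + 1) → ℕ) := by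
  obtain ⟨h, φ, hφ, h1⟩ := ha
  refine ⟨fun j => ?_, fun i => (φ i).castSucc, fun i j hij => by simpa using hφ hij,
    fun i => by simpa using h1 i⟩
  refine Fin.lastCases ?_ (fun j => ?_) j
  · simpa using hv
  · simpa using h j

theorem IsSubshuffle.snoc_succ {n d s : ℕ} {a : Fin n → ℕ} (ha : IsSubshuffle d s a) {v : ℕ}
    (hv : v < d) (hvs : v ≤ s) : IsSubshuffle d (s + 1) (Fin.snoc a v : Fin (n + 1) → ℕ) := by
  obtain ⟨h, φ, hφ, h1⟩ := ha
  refine ⟨fun j => ?_, Fin.snoc (fun i => (φ i).castSucc) (Fin.last n), fun i j => ?_, fun i => ?_⟩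
  · refine Fin.lastCases ?_ (fun j => ?_) j
    · simpa using hv
    · simpa using h j
  · refine Fin.lastCases ?_ (fun j => ?_) j <;> refine Fin.lastCases ?_ (fun i => ?_) i
    · simp
    · intro _; simp [Fin.castSucc_lt_last]
    · intro h; exact absurd h (by simp [Fin.le_last])
    · intro hij; simpa using hφ (by simpa using hij)
  · refine Fin.lastCases ?_ (fun i => ?_) i
    · simpa using hvs
    · simpa using h1 i

theorem IsSubshuffle.mono {n d s : ℕ} {a : Fin n → ℕ} (ha : IsSubshuffle d (s + 1) a) :
    IsSubshuffle d s a := by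
  obtain ⟨h, φ, hφ, h1⟩ := ha
  exact ⟨h, fun i => φ i.castSucc, fun i j hij => hφ (by simpa using hij),
    fun i => by simpa using h1 i.castSucc⟩

/-- Deleting the last entry: either the chain of the subshuffle avoids it, or it is the end of the
chain. Both the spanning argument and the count follow this recursion. -/
theorem isSubshuffle_snoc_iff {n d s : ℕ} (a : Fin n → ℕ) (v : ℕ) :
    IsSubshuffle d (s + 1) (Fin.snoc a v : Fin (n + 1) → ℕ) ↔
      v < d ∧ (IsSubshuffle d (s + 1) a ∨ IsSubshuffle d s a ∧ v ≤ s) := by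
  constructor
  · rintro ⟨h, φ, hφ, h1⟩
    have hv : v < d := by simpa using h (Fin.last n)
    have ha : ∀ j, a j < d := fun j => by simpa using h j.castSucc
    refine ⟨hv, ?_⟩
    by_cases hl : φ (Fin.last s) = Fin.last n
    · right
      have hne : ∀ i : Fin s, φ i.castSucc ≠ Fin.last n := fun i =>
        (lt_of_lt_of_eq (hφ (Fin.castSucc_lt_last i)) hl).ne
      refine ⟨⟨ha, fun i => (φ i.castSucc).castPred (hne i), fun i j hij => ?_, fun i => ?_⟩, ?_⟩
      · simpa using hφ (by simpa using hij)
      · have := h1 i.castSucc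
        rw [← Fin.castSucc_castPred _ (hne i), Fin.snoc_castSucc] at this
        simpa using this
      · have := h1 (Fin.last s)
        rw [hl, Fin.snoc_last] at this
        simpa using this
    · left
      have hne : ∀ i, φ i ≠ Fin.last n := fun i =>
        ((hφ.monotone (Fin.le_last i)).trans_lt (Fin.lt_last_iff_ne_last.2 hl)).ne
      refine ⟨ha, fun i => (φ i).castPred (hne i), fun i j hij => ?_, fun i => ?_⟩
      · simpa using hφ hij
      · have := h1 i
        rwa [← Fin.castSucc_castPred _ (hne i), Fin.snoc_castSucc] at this
  · rintro ⟨hv, h | ⟨h, hs⟩⟩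
    · exact h.snoc hv
    · exact h.snoc_succ hv hs

section Univariate

open Polynomial

/-! ### Monomials spanning algebras of roots -/

/-- A polynomial of degree less than `m`, evaluated at `z` and multiplied by `M`, lies in every
additive subgroup containing the products `φ c * z ^ i * M` with `i < m`. -/
theorem eval₂_mul_mem {R S : Type*} [CommRing R] [CommRing S] (φ : R →+* S) (W : AddSubgroup S)
    (z M : S) {m : ℕ} (f : R[X]) (hf : f.degree < m)
    (h : ∀ c, ∀ i < m, φ c * z ^ i * M ∈ W) : f.eval₂ φ z * M ∈ W := by
  rw [eval₂_eq_sum, sum_def, Finset.sum_mul]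
  refine sum_mem fun i hi => h _ _ ?_
  have := (le_degree_of_mem_supp i hi).trans_lt hf
  exact_mod_cast this

/-- Each element of `AdjoinRoot Q` is represented by a polynomial of degree less than that
of `Q`. -/
theorem exists_mk_eq_degree_lt {R : Type*} [CommRing R] [Nontrivial R] {Q : R[X]} (hQ : Q.Monic)
    (r : AdjoinRoot Q) : ∃ f : R[X], f.degree < Q.natDegree ∧ AdjoinRoot.mk Q f = r := by
  obtain ⟨g, rfl⟩ := AdjoinRoot.mk_surjective r
  refine ⟨g %ₘ Q, (degree_modByMonic_lt g hQ).trans_eq (degree_eq_natDegree hQ.ne_zero), ?_⟩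
  rw [AdjoinRoot.mk_eq_mk]
  exact ⟨-(g /ₘ Q), by linear_combination modByMonic_add_div g Q⟩

/-- Dividing the monic polynomial `Q` by its tautological root over `AdjoinRoot Q`. -/
theorem exists_map_of_eq_mul {R : Type*} [CommRing R] {Q : R[X]} (hQ : Q.Monic)
    [Nontrivial (AdjoinRoot Q)] :
    ∃ Q' : (AdjoinRoot Q)[X], Q.map (AdjoinRoot.of Q) = (X - C (AdjoinRoot.root Q)) * Q' ∧
      Q'.Monic ∧ Q.natDegree = Q'.natDegree + 1 := by
  obtain ⟨Q', h⟩ := dvd_iff_isRoot.2 (AdjoinRoot.isRoot_root Q)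
  have hm : Q'.Monic := (monic_X_sub_C _).of_mul_monic_left (h ▸ hQ.map _)
  refine ⟨Q', h, hm, ?_⟩
  rw [← hQ.natDegree_map (AdjoinRoot.of Q), h, (monic_X_sub_C _).natDegree_mul hm, natDegree_X_sub_C,
    add_comm]

theorem dvd_of_mul_dvd_mul_monic {R : Type*} [CommRing R] {p q r : R[X]} (hr : r.Monic)
    (h : p * r ∣ q * r) : p ∣ q := by
  obtain ⟨c, hc⟩ := h
  refine ⟨c, hr.isRegular.right ?_⟩
  change q * r = p * c * r
  rw [hc]
  ring

/-- If `S` is generated by `R` and `x_1, …, x_{n+1}`, then a quotient of `S` in which the last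
variable is a root of `Q` is generated by `AdjoinRoot Q` and the other variables. -/
theorem closure_range_lift {R S T : Type*} [CommRing R] [CommRing S] [CommRing T] {n : ℕ}
    (φ : R →+* S) (x : Fin (n + 1) → S)
    (hgen : Subring.closure (Set.range φ ∪ Set.range x) = ⊤)
    (π : S →+* T) (hπ : Function.Surjective π) (Q : R[X])
    (h : Q.eval₂ (π.comp φ) (π (x (Fin.last n))) = 0) :
    Subring.closure (Set.range (AdjoinRoot.lift (π.comp φ) (π (x (Fin.last n))) h) ∪
      Set.range fun i : Fin n => π (x i.castSucc)) = ⊤ := by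
  rw [eq_top_iff, ← RingHom.range_eq_top.2 hπ, RingHom.range_eq_map, ← hgen, RingHom.map_closure,
    Subring.closure_le]
  rintro _ ⟨_, ⟨r, rfl⟩ | ⟨i, rfl⟩, rfl⟩
  · exact Subring.subset_closure (Or.inl ⟨AdjoinRoot.of Q r, by simp⟩)
  · refine Fin.lastCases ?_ (fun i => ?_) i
    · exact Subring.subset_closure (Or.inl ⟨AdjoinRoot.root Q, by simp⟩)
    · exact Subring.subset_closure (Or.inr ⟨i, rfl⟩)

theorem addSubgroup_closure_eq_top_of_fin_zero {R S : Type*} [CommRing R] [CommRing S]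
    (φ : R →+* S) (x : Fin 0 → S) (hgen : Subring.closure (Set.range φ ∪ Set.range x) = ⊤)
    (A : Set (Fin 0 → ℕ)) (hA : ∀ a, a ∈ A) :
    AddSubgroup.closure {q | ∃ r, ∃ a ∈ A, q = φ r * ∏ i, x i ^ a i} = ⊤ := by
  rw [eq_top_iff]
  intro p _
  have hp : p ∈ Subring.closure (Set.range φ ∪ Set.range x) := hgen ▸ Subring.mem_top p
  rw [Set.range_eq_empty x, Set.union_empty, ← RingHom.coe_range, Subring.closure_eq] at hp
  obtain ⟨r, rfl⟩ := hp
  exact AddSubgroup.subset_closure ⟨r, Fin.elim0, hA _, by simp⟩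

/-- Let `S` be generated over `R` by `x_1, …, x_n`, all roots of a monic polynomial `P` of degree
`d`, and let a monic divisor `Q` of `P` of degree `s` divide `∏ (X - x_i)`. Then the monomials
`x^a` with `a` dominated by a shuffle of `(0, …, s-1)` with `(d-1, …, d-1)` span `S` over `R`.

The proof is by induction on `n`, splitting off the last variable `z`. In `S / Q(z)` the variable
`z` contributes the exponents below `s`, and the other variables satisfy the hypotheses for
`Q / (X - z)`. The ideal `Q(z) S` is a cyclic module on which `z` is a root of `P / Q`, and there
the other variables satisfy the hypotheses for `Q` itself.

Spans are additive subgroups generated by the `R`-multiples, because `R` and its ring homomorphism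
to `S` change in the induction. -/
theorem closure_monomials_isSubshuffle_eq_top.{u} (d n : ℕ) : ∀ (s : ℕ) {R S : Type u} [CommRing R]
    [CommRing S] (φ : R →+* S) (x : Fin n → S) (P Q : R[X]), P.Monic → P.natDegree = d →
    Q.Monic → Q.natDegree = s → Q ∣ P → (∀ i, P.eval₂ φ (x i) = 0) →
    Q.map φ ∣ ∏ i, (X - C (x i)) → Subring.closure (Set.range φ ∪ Set.range x) = ⊤ →
    AddSubgroup.closure {q | ∃ r, ∃ a ∈ {a | IsSubshuffle d s a}, q = φ r * ∏ i, x i ^ a i} = ⊤ := by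
  induction n with
  | zero =>
    intro s R S _ _ φ x P Q hP hPd hQ hQs hQP hx hdvd hgen
    rcases subsingleton_or_nontrivial S with _ | _
    · exact Subsingleton.elim _ _
    obtain rfl : s = 0 := by
      have h1 : Q.map φ ∣ 1 := by simpa using hdvd
      have := congrArg natDegree ((hQ.map φ).eq_one_of_isUnit (isUnit_of_dvd_one h1))
      rwa [hQ.natDegree_map, hQs, natDegree_one] at this
    exact addSubgroup_closure_eq_top_of_fin_zero φ x hgen _
      fun a => ⟨fun j => j.elim0, Fin.elim0, fun i => i.elim0, fun i => i.elim0⟩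
  | succ n ih =>
    intro s R S _ _ φ x P Q hP hPd hQ hQs hQP hx hdvd hgen
    rcases subsingleton_or_nontrivial S with _ | _
    · exact Subsingleton.elim _ _
    have : Nontrivial R := φ.domain_nontrivial
    set W := AddSubgroup.closure {q | ∃ r, ∃ a ∈ {a | IsSubshuffle d s a},
      q = φ r * ∏ i, x i ^ a i}
    set z := x (Fin.last n)
    set q := Q.eval₂ φ z with hq
    obtain ⟨U, hU⟩ := hQP
    have hUm : U.Monic := hQ.of_mul_monic_left (hU ▸ hP)
    have hdeg : d = s + U.natDegree := by rw [← hPd, hU, hQ.natDegree_mul hUm, hQs]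
    have hmemW : ∀ (r : R) (a : Fin n → ℕ) (v : ℕ),
        IsSubshuffle d s (Fin.snoc a v : Fin (n + 1) → ℕ) →
        φ r * z ^ v * ∏ i : Fin n, x i.castSucc ^ a i ∈ W := fun r a v h => by
      refine AddSubgroup.subset_closure ⟨r, _, h, ?_⟩
      rw [Fin.prod_univ_castSucc]
      simp only [Fin.snoc_castSucc, Fin.snoc_last]
      ring
    have hmulz : (∏ i : Fin n, (X - C (x i.castSucc))) * (X - C z) = ∏ i, (X - C (x i)) := by
      rw [Fin.prod_univ_castSucc]
    -- Modulo `Q(z)`, the cofactor of `X - z` in `Q` divides the remaining product.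
    have stage1 : ∀ p : S, ∃ w ∈ W, p - w ∈ Ideal.span {q} := by
      let π := Ideal.Quotient.mk (Ideal.span {q})
      have hroot : Q.eval₂ (π.comp φ) (π z) = 0 := by
        rw [← hom_eval₂]
        exact Ideal.Quotient.eq_zero_iff_mem.2 (Ideal.subset_span rfl)
      let ψ := AdjoinRoot.lift (π.comp φ) (π z) hroot
      suffices h : (⊤ : AddSubgroup (S ⧸ Ideal.span {q})) ≤ W.map π.toAddMonoidHom by
        intro p
        obtain ⟨w, hw, hwp⟩ := h (AddSubgroup.mem_top (π p))
        exact ⟨w, hw, Ideal.Quotient.eq.1 hwp.symm⟩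
      rcases subsingleton_or_nontrivial (S ⧸ Ideal.span {q}) with _ | _
      · exact (Subsingleton.elim _ _).le
      have : Nontrivial (AdjoinRoot Q) := ψ.domain_nontrivial
      obtain ⟨Q', hQ', hQ'm, hQ's⟩ := exists_map_of_eq_mul hQ
      have hψof : ψ.comp (AdjoinRoot.of Q) = π.comp φ := AdjoinRoot.lift_comp_of hroot
      rw [← ih Q'.natDegree ψ (fun i => π (x i.castSucc)) (P.map (AdjoinRoot.of Q)) Q' (hP.map _)
        (by rw [hP.natDegree_map, hPd]) hQ'm rfl ?_ ?_ ?_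
        (closure_range_lift φ x hgen π Ideal.Quotient.mk_surjective Q hroot), AddSubgroup.closure_le]
      · rintro _ ⟨r, a, ha, rfl⟩
        obtain ⟨f, hf, rfl⟩ := exists_mk_eq_degree_lt hQ r
        refine ⟨f.eval₂ φ z * ∏ i : Fin n, x i.castSucc ^ a i,
          eval₂_mul_mem φ W z _ f hf fun c v hv => hmemW c a v ?_, ?_⟩
        · rw [← hQs, hQ's]
          -- `v < d`, since the degree of `Q` is at most that of `P`
          exact IsSubshuffle.snoc_succ ha (by omega) (by omega)
        · simp [ψ, π, hom_eval₂]
      · exact (Dvd.intro_left _ hQ'.symm).trans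
          (by rw [hU, Polynomial.map_mul]; exact dvd_mul_right _ _)
      · intro i
        rw [eval₂_map, hψof, ← hom_eval₂, hx, map_zero]
      · have h1 := Polynomial.map_dvd π hdvd
        rw [map_map, ← hψof, ← map_map, hQ', ← hmulz] at h1
        simp only [Polynomial.map_mul, Polynomial.map_prod, Polynomial.map_sub, map_X, map_C] at h1
        rw [AdjoinRoot.lift_root, mul_comm] at h1
        exact dvd_of_mul_dvd_mul_monic (monic_X_sub_C _) h1
    -- On the ideal generated by `Q(z)`, the element `z` satisfies the cofactor `U` of `Q` in `P`.
    have stage2 : ∀ p : S, q * p ∈ W := by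
      let K : Ideal S := LinearMap.ker (LinearMap.mulLeft S q)
      have hK : ∀ u, u ∈ K ↔ q * u = 0 := fun u => by simp [K]
      let π := Ideal.Quotient.mk K
      have hroot : U.eval₂ (π.comp φ) (π z) = 0 := by
        rw [← hom_eval₂]
        refine Ideal.Quotient.eq_zero_iff_mem.2 ((hK _).2 ?_)
        rw [hq, ← eval₂_mul, ← hU, hx]
      let ψ := AdjoinRoot.lift (π.comp φ) (π z) hroot
      suffices h : (⊤ : AddSubgroup (S ⧸ K)) ≤
          (W.comap (AddMonoidHom.mulLeft q)).map π.toAddMonoidHom by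
        intro p
        obtain ⟨w, hw, hwp⟩ := h (AddSubgroup.mem_top (π p))
        have h1 : q * (w - p) = 0 := (hK _).1 (Ideal.Quotient.eq.1 hwp)
        rw [mul_sub, sub_eq_zero] at h1
        rw [← h1]
        exact hw
      rcases subsingleton_or_nontrivial (S ⧸ K) with _ | _
      · exact (Subsingleton.elim _ _).le
      have : Nontrivial (AdjoinRoot U) := ψ.domain_nontrivial
      have hψof : ψ.comp (AdjoinRoot.of U) = π.comp φ := AdjoinRoot.lift_comp_of hroot
      rw [← ih s ψ (fun i => π (x i.castSucc)) (P.map (AdjoinRoot.of U)) (Q.map (AdjoinRoot.of U))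
        (hP.map _) (by rw [hP.natDegree_map, hPd]) (hQ.map _) (by rw [hQ.natDegree_map, hQs]) ?_ ?_ ?_
        (closure_range_lift φ x hgen π Ideal.Quotient.mk_surjective U hroot), AddSubgroup.closure_le]
      · rintro _ ⟨r, a, ha, rfl⟩
        obtain ⟨f, hf, rfl⟩ := exists_mk_eq_degree_lt hUm r
        refine ⟨f.eval₂ φ z * ∏ i : Fin n, x i.castSucc ^ a i, ?_, ?_⟩
        · change q * (f.eval₂ φ z * ∏ i : Fin n, x i.castSucc ^ a i) ∈ W
          rw [← mul_assoc, hq, ← eval₂_mul]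
          refine eval₂_mul_mem φ W z _ (Q * f) (m := d) ?_ fun c v hv =>
            hmemW c a v (IsSubshuffle.snoc ha hv)
          rw [mul_comm, hQ.degree_mul, add_comm, degree_eq_natDegree hQ.ne_zero, hQs, hdeg, Nat.cast_add]
          exact WithBot.add_lt_add_left (by simp) hf
        · simp [ψ, π, hom_eval₂]
      · rw [hU]
        exact Polynomial.map_dvd _ (dvd_mul_right _ _)
      · intro i
        rw [eval₂_map, hψof, ← hom_eval₂, hx, map_zero]
      · obtain ⟨G, hG⟩ := hdvd
        -- evaluating `(X - z) ∏ (X - x_i) = Q G` at `z` gives `Q(z) G(z) = 0`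
        have hGz : (G.map π).IsRoot (π z) := by
          have h1 := congrArg (eval z) hG
          rw [← hmulz, eval_mul, eval_mul, eval_map] at h1
          rw [IsRoot, eval_map, eval₂_at_apply]
          refine Ideal.Quotient.eq_zero_iff_mem.2 ((hK _).2 ?_)
          rw [hq, ← h1]
          simp
        obtain ⟨G', hG'⟩ := dvd_iff_isRoot.2 hGz
        have h1 := congrArg (Polynomial.map π) hG
        rw [← hmulz, Polynomial.map_mul, Polynomial.map_mul, hG', map_map, ← hψof, ← map_map] at h1
        simp only [Polynomial.map_prod, Polynomial.map_sub, map_X, map_C] at h1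
        refine ⟨G', (monic_X_sub_C (π z)).isRegular.right ?_⟩
        change _ * _ = _ * _
        rw [h1]
        ring
    rw [eq_top_iff]
    intro p _
    obtain ⟨w, hw, hwp⟩ := stage1 p
    obtain ⟨u, hu⟩ := Ideal.mem_span_singleton'.1 hwp
    have : p = w + q * u := by rw [mul_comm, hu]; ring
    rw [this]
    exact add_mem hw (stage2 u)

/-- If `∏ (X - y_i)` divides a monic polynomial `T` of degree `k` over `R`, then the monomials
`y^b` with `b_i < k - d + i` (for `i = 1, …, d`) span the ring generated by `y_1, …, y_d` over `R`:
the last variable is a root of `T`, and the others satisfy the hypotheses for the cofactor of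
degree `k - 1`. -/
theorem closure_monomials_flag_eq_top.{u} (d : ℕ) : ∀ (k : ℕ) {R S : Type u} [CommRing R]
    [CommRing S] (φ : R →+* S) (y : Fin d → S) (T : R[X]), d ≤ k → T.Monic → T.natDegree = k →
    ∏ i, (X - C (y i)) ∣ T.map φ → Subring.closure (Set.range φ ∪ Set.range y) = ⊤ →
    AddSubgroup.closure {q | ∃ r, ∃ b ∈ {b : Fin d → ℕ | ∀ i, b i < k - d + ((i : ℕ) + 1)},
      q = φ r * ∏ i, y i ^ b i} = ⊤ := by
  induction d with
  | zero =>
    intro k R S _ _ φ y T _ _ _ _ hgen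
    exact addSubgroup_closure_eq_top_of_fin_zero φ y hgen _ fun b i => i.elim0
  | succ d ih =>
    intro k R S _ _ φ y T hdk hT hTk hdvd hgen
    rcases subsingleton_or_nontrivial S with _ | _
    · exact Subsingleton.elim _ _
    have : Nontrivial R := φ.domain_nontrivial
    set W := AddSubgroup.closure {q | ∃ r,
      ∃ b ∈ {b : Fin (d + 1) → ℕ | ∀ i, b i < k - (d + 1) + ((i : ℕ) + 1)},
        q = φ r * ∏ i, y i ^ b i}
    set z := y (Fin.last d)
    rw [Fin.prod_univ_castSucc] at hdvd
    have hroot : T.eval₂ φ z = 0 := by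
      have h1 := dvd_iff_isRoot.1 ((dvd_mul_left _ _).trans hdvd)
      rwa [IsRoot, eval_map] at h1
    let ψ := AdjoinRoot.lift φ z hroot
    have : Nontrivial (AdjoinRoot T) := ψ.domain_nontrivial
    obtain ⟨T', hT', hT'm, hT'k⟩ := exists_map_of_eq_mul hT
    have hψof : ψ.comp (AdjoinRoot.of T) = φ := AdjoinRoot.lift_comp_of hroot
    rw [eq_top_iff, ← ih T'.natDegree ψ (fun i => y i.castSucc) T' (by omega) hT'm rfl ?_
      (closure_range_lift φ y hgen (RingHom.id S) Function.surjective_id T hroot),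
      AddSubgroup.closure_le]
    · rintro _ ⟨r, b, hb, rfl⟩
      obtain ⟨f, hf, rfl⟩ := exists_mk_eq_degree_lt hT r
      simp only [ψ, AdjoinRoot.lift_mk]
      refine eval₂_mul_mem φ W z _ f hf fun c v hv => ?_
      refine AddSubgroup.subset_closure ⟨c, Fin.snoc b v, fun i => ?_, ?_⟩
      · refine Fin.lastCases ?_ (fun i => ?_) i
        · simp
          omega
        · have := hb i
          simp
          omega
      · rw [Fin.prod_univ_castSucc]
        simp only [Fin.snoc_castSucc, Fin.snoc_last]
        ring
    · rw [← hψof, ← map_map, hT', Polynomial.map_mul, Polynomial.map_sub, map_X, map_C,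
        AdjoinRoot.lift_root, mul_comm (X - C z)] at hdvd
      exact dvd_of_mul_dvd_mul_monic (monic_X_sub_C z) hdvd

/-! ### Generating functions of symmetric polynomials -/

/-- The value of the complete homogeneous symmetric polynomial `h_r` at `y`. -/
def hval {σ A : Type*} [Fintype σ] [DecidableEq σ] [CommRing A] (y : σ → A) (r : ℕ) : A :=
  ∑ s : Sym σ r, (s.1.map y).prod

theorem hval_zero {σ A : Type*} [Fintype σ] [DecidableEq σ] [CommRing A] (y : σ → A) :
    hval y 0 = 1 := by
  simp [hval, Sym.eq_nil_of_card_zero]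

theorem aeval_hsymm (R : Type*) {σ A : Type*} [Fintype σ] [DecidableEq σ] [CommRing R] [CommRing A]
    [Algebra R A] (y : σ → A) (r : ℕ) :
    MvPolynomial.aeval y (MvPolynomial.hsymm σ R r) = hval y r := by
  simp [MvPolynomial.hsymm, hval, ← Multiset.prod_hom']

theorem hval_comp_equiv {σ τ A : Type*} [Fintype σ] [DecidableEq σ] [Fintype τ] [DecidableEq τ]
    [CommRing A] (e : σ ≃ τ) (y : τ → A) (r : ℕ) : hval (y ∘ e) r = hval y r := by
  refine Fintype.sum_equiv (Sym.equivCongr e) _ _ fun s => ?_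
  simp [Function.comp_def]

theorem hval_option_succ {σ A : Type*} [Fintype σ] [DecidableEq σ] [DecidableEq (Option σ)]
    [CommRing A]
    (y : Option σ → A) (r : ℕ) :
    hval y (r + 1) = y none * hval y r + hval (fun i => y (some i)) (r + 1) := by
  rw [hval, ← Equiv.sum_comp symOptionSuccEquiv.symm, Fintype.sum_sum_type, hval, hval,
    Finset.mul_sum]
  congr 1
  · refine Finset.sum_congr rfl fun s _ => ?_
    change (Multiset.map y (none ::ₛ s : Sym (Option σ) (r + 1)).1).prod = _
    rw [← Multiset.prod_cons, ← Multiset.map_cons]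
    rfl
  · refine Finset.sum_congr rfl fun s _ => ?_
    simp [symOptionSuccEquiv]

/-- The generating function of the complete homogeneous symmetric polynomials is the inverse of
`∏ (1 - y_i X)`. -/
theorem mk_hval_mul_prod {A : Type*} [CommRing A] (σ : Type) [Finite σ] :
    ∀ (_ : Fintype σ) (_ : DecidableEq σ) (y : σ → A),
      PowerSeries.mk (hval y) * ((∏ i, (1 - C (y i) * X) : A[X]) : PowerSeries A) = 1 := by
  refine Finite.induction_empty_option (P := fun σ => ∀ (_ : Fintype σ) (_ : DecidableEq σ)
    (y : σ → A), PowerSeries.mk (hval y) *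
      ((∏ i, (1 - C (y i) * X) : A[X]) : PowerSeries A) = 1) ?_ ?_ ?_ σ
  · intro α β e ih _ _ y
    classical
    let _ := Fintype.ofEquiv β e.symm
    have h := ih inferInstance inferInstance (y ∘ e)
    rw [← Equiv.prod_comp e, ← h]
    congr 1
    ext r
    simp [← hval_comp_equiv e]
  · intro _ _ y
    ext r
    rcases r with _ | r
    · simp [hval_zero]
    · simp [hval, PowerSeries.coeff_one]
  · intro α _ ih hf _ y
    classical
    obtain rfl : hf = instFintypeOption := Subsingleton.elim _ _
    rw [Fintype.prod_option, Polynomial.coe_mul, ← mul_assoc,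
      ← ih inferInstance inferInstance fun i => y (some i)]
    congr 1
    ext r
    simp only [coe_sub, coe_one, coe_mul, coe_C, coe_X, mul_sub, mul_one, map_sub,
      PowerSeries.coeff_mk]
    rw [mul_left_comm, PowerSeries.coeff_C_mul]
    rcases r with _ | r
    · simp [hval_zero]
    · rw [PowerSeries.coeff_succ_mul_X, PowerSeries.coeff_mk, hval_option_succ]
      ring

theorem coeff_prod_one_sub {σ A : Type*} [Fintype σ] [CommRing A] (x : σ → A) (r : ℕ) :
    (∏ i, (1 - C (x i) * X) : A[X]).coeff r = (-1) ^ r * (Finset.univ.val.map x).esymm r := by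
  have h : ∀ i, (1 - C (x i) * X : A[X]) = 1 + C (-x i) * X := fun i => by simp [sub_eq_add_neg]
  simp_rw [h]
  rw [Finset.prod_one_add, finsetSum_coeff, Finset.esymm_map_val, Finset.mul_sum,
    Finset.powersetCard_eq_filter, Finset.sum_filter]
  refine Finset.sum_congr rfl fun t _ => ?_
  rw [Finset.prod_mul_distrib, Finset.prod_const, ← map_prod, coeff_C_mul, coeff_X_pow]
  by_cases ht : t.card = r
  · simp [ht, Finset.prod_neg]
  · simp [ht, Ne.symm ht]

theorem natDegree_prod_one_sub_le {σ A : Type*} [CommRing A] (s : Finset σ) (x : σ → A) :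
    (∏ i ∈ s, (1 - C (x i) * X) : A[X]).natDegree ≤ s.card := by
  refine (natDegree_prod_le _ _).trans ((Finset.sum_le_card_nsmul _ _ 1 fun i _ => ?_).trans
    (by simp))
  compute_degree

theorem reflect_prod_one_sub {σ A : Type*} [CommRing A] (s : Finset σ) (x : σ → A) :
    reflect s.card (∏ i ∈ s, (1 - C (x i) * X) : A[X]) = ∏ i ∈ s, (X - C (x i)) := by
  classical
  induction s using Finset.induction_on with
  | empty => simp [reflect_one]
  | insert a s ha ih =>
    rw [Finset.prod_insert ha, Finset.prod_insert ha, Finset.card_insert_of_notMem ha, add_comm,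
      reflect_mul _ _ (by compute_degree) (natDegree_prod_one_sub_le s x), ih, reflect_sub]
    congr 1
    simp [reflect_C_mul, reflect_one]

/-- The alternating sum `e_r(x) - e_{r-1}(x) h_1(y) + ⋯ + (-1)^r h_r(y)`. -/
def ehSum {A : Type*} [CommRing A] {n d : ℕ} (x : Fin n → A) (y : Fin d → A) (r : ℕ) : A :=
  ∑ j ∈ Finset.range (r + 1), (-1) ^ j * (Finset.univ.val.map x).esymm (r - j) * hval y j

/-- Up to sign, `ehSum x y` is the coefficient sequence of `∏ (1 - x_i X) / ∏ (1 - y_j X)`. -/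
theorem mk_ehSum {A : Type*} [CommRing A] {n d : ℕ} (x : Fin n → A) (y : Fin d → A) :
    PowerSeries.mk (fun r => (-1) ^ r * ehSum x y r) =
      PowerSeries.mk (hval y) * ((∏ i, (1 - C (x i) * X) : A[X]) : PowerSeries A) := by
  ext r
  rw [PowerSeries.coeff_mk, PowerSeries.coeff_mul,
    Finset.Nat.sum_antidiagonal_eq_sum_range_succ_mk, ehSum, Finset.mul_sum]
  refine Finset.sum_congr rfl fun j hj => ?_
  have hj : j ≤ r := Nat.lt_succ_iff.1 (Finset.mem_range.1 hj)
  obtain ⟨m, rfl⟩ := Nat.exists_eq_add_of_le hj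
  simp only [Polynomial.coeff_coe, coeff_prod_one_sub, PowerSeries.coeff_mk, Nat.add_sub_cancel_left]
  have h : ((-1 : A) ^ j) * (-1) ^ j = 1 := by rw [← mul_pow]; simp
  rw [pow_add]
  linear_combination ((-1) ^ m * (Finset.univ.val.map x).esymm m * hval y j) * h

/-- The relations `ehSum x y r = 0` for `r > n - d` say that `∏ (X - y_j)` divides
`∏ (X - x_i)`. -/
theorem forall_ehSum_eq_zero_iff {A : Type*} [CommRing A] {n d : ℕ} (hdn : d ≤ n)
    (x : Fin n → A) (y : Fin d → A) :
    (∀ r, n - d < r → ehSum x y r = 0) ↔ ∏ j, (X - C (y j)) ∣ ∏ i, (X - C (x i)) := by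
  have hx := reflect_prod_one_sub Finset.univ x
  have hy := reflect_prod_one_sub Finset.univ y
  have hdx := natDegree_prod_one_sub_le Finset.univ x
  have hdy := natDegree_prod_one_sub_le Finset.univ y
  rw [Finset.card_univ, Fintype.card_fin] at hx hy hdx hdy
  have hn : n = (n - d) + d := (Nat.sub_add_cancel hdn).symm
  constructor
  · intro h
    -- the quotient power series is a polynomial of degree at most `n - d`
    let G : A[X] := (PowerSeries.mk fun r => (-1) ^ r * ehSum x y r).trunc (n - d + 1)
    have hG : (G : PowerSeries A) = PowerSeries.mk fun r => (-1) ^ r * ehSum x y r := by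
      ext r
      rw [Polynomial.coeff_coe, PowerSeries.coeff_trunc, PowerSeries.coeff_mk]
      split_ifs with hr
      · rfl
      · rw [h r (by omega), mul_zero]
    have hGd : G.natDegree ≤ n - d := Nat.lt_succ_iff.1 (PowerSeries.natDegree_trunc_lt _ _)
    have hmul : G * ∏ j, (1 - C (y j) * X) = ∏ i, (1 - C (x i) * X) := by
      apply Polynomial.coe_injective
      rw [Polynomial.coe_mul, hG, mk_ehSum, mul_right_comm, mk_hval_mul_prod, one_mul]
    refine Dvd.intro_left (reflect (n - d) G) ?_
    rw [← hx, ← hy, ← hmul, ← reflect_mul _ _ hGd hdy, ← hn]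
  · rintro ⟨G, hG⟩ r hr
    rcases subsingleton_or_nontrivial A with _ | _
    · exact Subsingleton.elim _ _
    have hmx : (∏ i, (X - C (x i))).Monic := monic_prod_X_sub_C _ _
    have hmy : (∏ j, (X - C (y j))).Monic := monic_prod_X_sub_C _ _
    have hmG : G.Monic := hmy.of_mul_monic_left (hG ▸ hmx)
    have hGd : G.natDegree = n - d := by
      have := congrArg natDegree hG
      rw [hmy.natDegree_mul hmG, natDegree_prod_of_monic _ _ fun i _ => monic_X_sub_C _,
        natDegree_prod_of_monic _ _ fun i _ => monic_X_sub_C _] at this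
      simp at this
      omega
    have hdy' : (∏ j, (X - C (y j))).natDegree ≤ d := by
      rw [natDegree_prod_of_monic _ _ fun i _ => monic_X_sub_C _]
      simp
    have hmul : (reflect (n - d) G) * ∏ j, (1 - C (y j) * X) = ∏ i, (1 - C (x i) * X) := by
      have h := congrArg (reflect n) hG
      rw [← hx, reflect_reflect, ← hy, mul_comm] at h
      conv_rhs at h => rw [hn, reflect_mul _ _ hGd.le (by rw [hy]; exact hdy'), reflect_reflect]
      exact h.symm
    have h := congrArg (PowerSeries.coeff r) (mk_ehSum x y)
    rw [← hmul, Polynomial.coe_mul, mul_left_comm, mk_hval_mul_prod, mul_one, Polynomial.coeff_coe,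
      PowerSeries.coeff_mk, coeff_reflect, revAt_eq_self_of_lt hr,
      coeff_eq_zero_of_natDegree_lt (by omega)] at h
    exact (isUnit_neg_one.pow r).mul_right_eq_zero.1 h

theorem prod_X_sub_C_dvd_of_injective {A : Type*} [CommRing A] {n d : ℕ} {x : Fin n → A}
    {y : Fin d → A} (σ : Fin d → Fin n) (hσ : Function.Injective σ) (h : ∀ j, y j = x (σ j)) :
    ∏ j, (X - C (y j)) ∣ ∏ i, (X - C (x i)) := by
  simp_rw [h]
  have h1 := Finset.prod_map Finset.univ ⟨σ, hσ⟩ fun i => X - C (x i)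
  simp only [Function.Embedding.coeFn_mk] at h1
  rw [← h1]
  exact Finset.prod_dvd_prod_of_subset _ _ _ (Finset.subset_univ _)

theorem sum_pow_mul_esymm {A : Type*} [CommRing A] {d : ℕ} (y : Fin d → A) (z : A) :
    ∑ j ∈ Finset.range (d + 1), (-1) ^ j * z ^ (d - j) * (Finset.univ.val.map y).esymm j =
      ∏ j, (z - y j) := by
  have h := congrArg (eval z) (Multiset.prod_X_sub_X_eq_sum_esymm (Finset.univ.val.map y))
  rw [Multiset.map_map] at h
  have h2 : (Multiset.map ((fun t => X - C t) ∘ y) Finset.univ.val).prod = ∏ j, (X - C (y j)) := rfl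
  rw [h2, eval_prod] at h
  simp only [eval_sub, eval_X, eval_C, eval_finsetSum, eval_mul, eval_pow, eval_neg, eval_one,
    Multiset.card_map, Finset.card_val, Finset.card_univ, Fintype.card_fin] at h
  rw [h]
  exact Finset.sum_congr rfl fun j _ => by ring

end Univariate

/-! ### Counting subshuffles and surjections -/

theorem finite_setOf_isSubshuffle (d s n : ℕ) :
    {a : Fin n → ℕ | IsSubshuffle d s a}.Finite :=
  (Set.Finite.pi fun _ : Fin n => Set.finite_Iio d).subset fun _ h j _ => h.1 j

theorem snoc_uncurry_injective (n : ℕ) :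
    Function.Injective fun p : (Fin n → ℕ) × ℕ => (Fin.snoc p.1 p.2 : Fin (n + 1) → ℕ) := by
  rintro ⟨a, v⟩ ⟨b, w⟩ h
  obtain ⟨h1, h2⟩ := Fin.snoc_inj.1 h
  exact Prod.ext h1 h2

theorem ncard_isSubshuffle_zero_right (d n : ℕ) :
    {a : Fin n → ℕ | IsSubshuffle d 0 a}.ncard = d ^ n := by
  have h : {a : Fin n → ℕ | IsSubshuffle d 0 a} =
      (Fintype.piFinset fun _ : Fin n => Finset.range d : Finset (Fin n → ℕ)) := by
    ext a
    simp only [Set.mem_ofPred_eq, Finset.mem_coe, Fintype.mem_piFinset, Finset.mem_range]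
    exact ⟨fun h => h.1, fun h => ⟨h, Fin.elim0, fun i => i.elim0, fun i => i.elim0⟩⟩
  rw [h, Set.ncard_coe_finset]
  simp

theorem ncard_isSubshuffle_zero_left (d s : ℕ) :
    {a : Fin 0 → ℕ | IsSubshuffle d (s + 1) a}.ncard = 0 := by
  have h : {a : Fin 0 → ℕ | IsSubshuffle d (s + 1) a} = ∅ :=
    Set.eq_empty_of_forall_notMem fun a ⟨_, φ, _, _⟩ => (φ 0).elim0
  rw [h, Set.ncard_empty]

theorem ncard_isSubshuffle_succ_succ (d s n : ℕ) (hs : s < d) :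
    {a : Fin (n + 1) → ℕ | IsSubshuffle d (s + 1) a}.ncard =
      (s + 1) * {a : Fin n → ℕ | IsSubshuffle d s a}.ncard +
        (d - (s + 1)) * {a : Fin n → ℕ | IsSubshuffle d (s + 1) a}.ncard := by
  have h : {a : Fin (n + 1) → ℕ | IsSubshuffle d (s + 1) a} =
      (fun p : (Fin n → ℕ) × ℕ => (Fin.snoc p.1 p.2 : Fin (n + 1) → ℕ)) ''
        ({a | IsSubshuffle d s a} ×ˢ (Finset.range (s + 1) : Set ℕ) ∪
          {a | IsSubshuffle d (s + 1) a} ×ˢ (Finset.Ico (s + 1) d : Set ℕ)) := by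
    ext a
    rw [← Fin.snoc_init_self a]
    rw [Set.mem_ofPred_eq, isSubshuffle_snoc_iff]
    have := (snoc_uncurry_injective n).mem_set_image (a := (Fin.init a, a (Fin.last n)))
      (s := ({a | IsSubshuffle d s a} ×ˢ (Finset.range (s + 1) : Set ℕ) ∪
          {a | IsSubshuffle d (s + 1) a} ×ˢ (Finset.Ico (s + 1) d : Set ℕ)))
    rw [this]
    simp only [Set.mem_union, Set.mem_prod, Set.mem_ofPred_eq, Finset.coe_range, Set.mem_Iio,
      Finset.coe_Ico, Set.mem_Ico]
    constructor
    · rintro ⟨h1, h2 | h2⟩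
      · rcases lt_or_ge (a (Fin.last n)) (s + 1) with h3 | h3
        · exact Or.inl ⟨h2.mono, h3⟩
        · exact Or.inr ⟨h2, h3, h1⟩
      · exact Or.inl ⟨h2.1, Nat.lt_succ_iff.2 h2.2⟩
    · rintro (h | h)
      · exact ⟨by omega, Or.inr ⟨h.1, Nat.lt_succ_iff.1 h.2⟩⟩
      · exact ⟨h.2.2, Or.inl h.1⟩
  rw [h, Set.ncard_image_of_injective _ (snoc_uncurry_injective n), Set.ncard_union_eq ?_
    ((finite_setOf_isSubshuffle d s n).prod (Finset.finite_toSet _))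
    ((finite_setOf_isSubshuffle d (s + 1) n).prod (Finset.finite_toSet _)), Set.ncard_prod,
    Set.ncard_prod, Set.ncard_coe_finset, Set.ncard_coe_finset]
  · simp [mul_comm]
  · rw [Set.disjoint_left]
    rintro ⟨a, v⟩ ⟨_, h1⟩ ⟨_, h2⟩
    simp at h1 h2
    omega

/-- The recursion in `n` changes `s` at fixed `d`; this relation between neighbouring values of `d`
turns it into the recursion of the Stirling numbers. -/
theorem ncard_isSubshuffle_succ_left (n : ℕ) : ∀ d s : ℕ, s ≤ d →
    {a : Fin n → ℕ | IsSubshuffle (d + 1) s a}.ncard =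
      {a : Fin n → ℕ | IsSubshuffle d s a}.ncard +
        {a : Fin n → ℕ | IsSubshuffle (d + 1) (s + 1) a}.ncard := by
  induction n with
  | zero =>
    rintro d (_ | s) h
    · simp [ncard_isSubshuffle_zero_right, ncard_isSubshuffle_zero_left]
    · simp [ncard_isSubshuffle_zero_left]
  | succ n ih =>
    rintro d (_ | s) h
    · rw [ncard_isSubshuffle_succ_succ _ _ _ (by omega), ncard_isSubshuffle_zero_right,
        ncard_isSubshuffle_zero_right, ncard_isSubshuffle_zero_right]
      have := ih d 0 (Nat.zero_le _)
      rw [ncard_isSubshuffle_zero_right, ncard_isSubshuffle_zero_right] at this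
      simp only [zero_add, one_mul, Nat.add_sub_cancel] at this ⊢
      rw [pow_succ (d + 1), mul_add_one, pow_succ d]
      nth_rewrite 1 [this]
      ring
    · obtain ⟨e, rfl⟩ := Nat.exists_eq_add_of_le h
      rw [ncard_isSubshuffle_succ_succ _ _ _ (by omega),
        ncard_isSubshuffle_succ_succ _ _ _ (by omega)]
      have h1 := ih (s + 1 + e) s (by omega)
      have h2 := ih (s + 1 + e) (s + 1) (by omega)
      rw [ncard_isSubshuffle_succ_succ _ _ _ (by omega), h1, h2,
        show s + 1 + e + 1 - (s + 1) = e + 1 by omega, show s + 1 + e - (s + 1) = e by omega,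
        show s + 1 + e + 1 - (s + 1 + 1) = e by omega]
      ring

theorem ncard_isSubshuffle_succ_succ_succ (n d s : ℕ) (hs : s ≤ d) :
    {a : Fin (n + 1) → ℕ | IsSubshuffle (d + 1) (s + 1) a}.ncard =
      (s + 1) * {a : Fin n → ℕ | IsSubshuffle d s a}.ncard +
        (d + 1) * {a : Fin n → ℕ | IsSubshuffle (d + 1) (s + 1) a}.ncard := by
  rw [ncard_isSubshuffle_succ_succ _ _ _ (by omega), ncard_isSubshuffle_succ_left n d s hs]
  obtain ⟨e, rfl⟩ := Nat.exists_eq_add_of_le hs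
  rw [show s + e + 1 - (s + 1) = e by omega]
  ring

/-- There are `d! * S(n, d)` sequences dominated by an `(n, d)`-staircase. -/
theorem ncard_isSubshuffle_self (n : ℕ) : ∀ d : ℕ,
    {a : Fin n → ℕ | IsSubshuffle d d a}.ncard = d.factorial * Nat.stirlingSecond n d := by
  induction n with
  | zero =>
    rintro (_ | d)
    · simp [ncard_isSubshuffle_zero_right]
    · simp [ncard_isSubshuffle_zero_left]
  | succ n ih =>
    rintro (_ | d)
    · simp [ncard_isSubshuffle_zero_right]
    · rw [ncard_isSubshuffle_succ_succ_succ n d d le_rfl, ih, ih, Nat.stirlingSecond_succ_succ,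
        Nat.factorial_succ]
      ring

/-- There are `d (d-1) ⋯ (d-j+1) * S(n, j)` functions into a set of size `d` whose image has
size `j`. -/
theorem card_filter_card_image_eq (n d : ℕ) : ∀ j : ℕ,
    (Finset.univ.filter fun g : Fin n → Fin d => (Finset.univ.image g).card = j).card =
      d.descFactorial j * Nat.stirlingSecond n j := by
  induction n with
  | zero =>
    rintro (_ | j) <;> simp
  | succ n ih =>
    intro j
    have himage : ∀ (v : Fin d) (g : Fin n → Fin d),
        Finset.univ.image (Fin.snoc g v : Fin (n + 1) → Fin d) = insert v (Finset.univ.image g) := by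
      intro v g
      ext w
      simp only [Finset.mem_image, Finset.mem_univ, true_and, Finset.mem_insert]
      rw [Fin.exists_fin_succ']
      simp [or_comm, eq_comm]
    have hcount : (Finset.univ.filter fun g : Fin (n + 1) → Fin d =>
        (Finset.univ.image g).card = j).card =
        ∑ g : Fin n → Fin d, (Finset.univ.filter fun v : Fin d =>
          (insert v (Finset.univ.image g)).card = j).card := by
      rw [Finset.card_filter, ← (Fin.snocEquiv fun _ : Fin (n + 1) => Fin d).sum_comp,
        Fintype.sum_prod_type_right]
      refine Finset.sum_congr rfl fun g _ => ?_
      rw [Finset.card_filter]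
      refine Finset.sum_congr rfl fun v _ => ?_
      rw [← himage]
      rfl
    -- `v` lies in the image of `g`, or enlarges it by one element
    have hfib : ∀ A : Finset (Fin d), (Finset.univ.filter fun v : Fin d =>
        (insert v A).card = j).card =
        (if A.card = j then j else 0) + (if A.card + 1 = j then d - A.card else 0) := by
      intro A
      have h1 : ∀ v, (insert v A).card = j ↔ (v ∈ A ∧ A.card = j) ∨ (v ∈ Aᶜ ∧ A.card + 1 = j) := by
        intro v
        by_cases hv : v ∈ A
        · simp [hv]
        · simp [hv]
      simp_rw [h1]
      split_ifs with h2 h3 h3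
      · omega
      · simp [h2]
      · have : (Finset.univ.filter fun v => (v ∈ A ∧ A.card = j) ∨ (v ∈ Aᶜ ∧ A.card + 1 = j)) = Aᶜ := by
          ext v
          simp [h2, h3]
        rw [this, Finset.card_compl, Fintype.card_fin, zero_add]
      · simp [h2, h3]
    rw [hcount]
    simp_rw [hfib]
    rw [Finset.sum_add_distrib, ← Finset.sum_filter, ← Finset.sum_filter, Finset.sum_const, ih,
      smul_eq_mul]
    rcases j with _ | j
    · simp
    · have h2 : ∑ g : Fin n → Fin d with (Finset.univ.image g).card + 1 = j + 1,
          (d - (Finset.univ.image g).card) =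
          (Finset.univ.filter fun g : Fin n → Fin d => (Finset.univ.image g).card = j).card *
            (d - j) := by
        simp only [add_left_inj]
        rw [Finset.sum_congr rfl (g := fun _ => d - j) fun g hg => by
          rw [(Finset.mem_filter.1 hg).2], Finset.sum_const, smul_eq_mul]
      rw [h2, ih, Nat.stirlingSecond_succ_succ, Nat.descFactorial_succ]
      ring

theorem card_surjective (n d : ℕ) :
    Fintype.card {g : Fin n → Fin d // Function.Surjective g} =
      d.factorial * Nat.stirlingSecond n d := by
  classical
  rw [Fintype.card_subtype, ← Nat.descFactorial_self, ← card_filter_card_image_eq]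
  congr 1
  ext g
  simp only [Finset.mem_filter, Finset.mem_univ, true_and]
  have h := (Finset.univ.image g).card_eq_iff_eq_univ
  rw [Fintype.card_fin] at h
  rw [h, Finset.eq_univ_iff_forall]
  simp [Function.Surjective]

section Multivariate

open MvPolynomial

/-! ### The relations as divisibilities -/

theorem map_ehSum {A B : Type*} [CommRing A] [CommRing B] (f : A →+* B) {n d : ℕ} (x : Fin n → A)
    (y : Fin d → A) (r : ℕ) :
    f (ehSum x y r) = ehSum (fun i => f (x i)) (fun j => f (y j)) r := by
  simp only [ehSum, hval, map_sum, map_mul, map_pow, map_neg, map_one, Finset.esymm_map_val,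
    map_prod, map_multiset_prod, Multiset.map_map, Function.comp_def]

theorem rename_eq_aeval {R σ τ : Type*} [CommRing R] (f : σ → τ) (p : MvPolynomial σ R) :
    rename f p = aeval (fun i => (X (f i) : MvPolynomial τ R)) p := by
  rw [← aeval_X_left_apply (rename f p), aeval_rename]
  rfl

theorem relT_eq_ehSum (n k d r : ℕ) :
    relT n k d r = ehSum (fun i => X (it i)) (fun j => X (iy j)) r := by
  refine Finset.sum_congr rfl fun j _ => ?_
  rw [← aeval_hsymm ℚ, ← aeval_esymm_eq_multiset_esymm (Fin k) ℚ, eT, hY, rename_eq_aeval,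
    rename_eq_aeval]

theorem relX_eq_ehSum (n k d r : ℕ) :
    relX n k d r = ehSum (fun i => X (ix i)) (fun j => X (iy j)) r := by
  refine Finset.sum_congr rfl fun j _ => ?_
  rw [← aeval_hsymm ℚ, ← aeval_esymm_eq_multiset_esymm (Fin n) ℚ, eX, hY, rename_eq_aeval,
    rename_eq_aeval]

theorem relPow_eq_prod (n k d : ℕ) (i : Fin n) :
    relPow n k d i = ∏ j, (X (ix i) - X (iy j)) := by
  rw [← sum_pow_mul_esymm]
  refine Finset.sum_congr rfl fun j _ => ?_
  rw [← aeval_esymm_eq_multiset_esymm (Fin d) ℚ, eY, rename_eq_aeval]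

theorem algebraMap_eq_rename (n k d : ℕ) (p : MvPolynomial (Fin k) ℚ) :
    algebraMap (MvPolynomial (Fin k) ℚ) (PolyXYT n k d) p = rename it p := rfl

instance (n k d : ℕ) : IsScalarTower ℚ (MvPolynomial (Fin k) ℚ) (PolyXYT n k d) :=
  IsScalarTower.of_algebraMap_eq fun q => by
    rw [algebraMap_eq_rename]
    simp [algebraMap_eq]

theorem smul_mk {n k d : ℕ} (I : Ideal (PolyXYT n k d)) (p : MvPolynomial (Fin k) ℚ)
    (q : PolyXYT n k d) : p • Ideal.Quotient.mk I q = Ideal.Quotient.mk I (rename it p * q) :=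
  rfl

/-- A ring homomorphism out of `ℚ[x,y,t]` kills `idealJ` if and only if, in the target,
`∏ (X - y_j)` divides both `∏ (X - t_i)` and `∏ (X - x_i)` and vanishes at each `x_i`. -/
theorem idealJ_le_ker_iff {n k d : ℕ} (hdk : d ≤ k) (hdn : d ≤ n) {A : Type*} [CommRing A]
    (π : PolyXYT n k d →+* A) :
    idealJ n k d ≤ RingHom.ker π ↔
      (∏ j, (.X - .C (π (X (iy j)))) ∣ ∏ i, (.X - .C (π (X (it i))) : Polynomial A)) ∧
      (∏ j, (.X - .C (π (X (iy j)))) ∣ ∏ i, (.X - .C (π (X (ix i))) : Polynomial A)) ∧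
      ∀ i, ∏ j, (π (X (ix i)) - π (X (iy j))) = 0 := by
  rw [← forall_ehSum_eq_zero_iff hdk, ← forall_ehSum_eq_zero_iff hdn, idealJ, Ideal.span_le,
    Set.union_subset_iff, Set.union_subset_iff, and_assoc]
  refine and_congr ?_ (and_congr ?_ ?_)
  · constructor
    · intro h r hr
      have := h ⟨r, hr, rfl⟩
      rwa [SetLike.mem_coe, RingHom.mem_ker, relT_eq_ehSum, map_ehSum] at this
    · rintro h _ ⟨r, hr, rfl⟩
      rw [SetLike.mem_coe, RingHom.mem_ker, relT_eq_ehSum, map_ehSum, h r hr]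
  · constructor
    · intro h r hr
      have := h ⟨r, hr, rfl⟩
      rwa [SetLike.mem_coe, RingHom.mem_ker, relX_eq_ehSum, map_ehSum] at this
    · rintro h _ ⟨r, hr, rfl⟩
      rw [SetLike.mem_coe, RingHom.mem_ker, relX_eq_ehSum, map_ehSum, h r hr]
  · constructor
    · intro h i
      have := h ⟨i, rfl⟩
      simpa only [SetLike.mem_coe, RingHom.mem_ker, relPow_eq_prod, map_prod, map_sub] using this
    · rintro h _ ⟨i, rfl⟩
      simpa only [SetLike.mem_coe, RingHom.mem_ker, relPow_eq_prod, map_prod, map_sub] using h i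

/-! ### The monomials span the quotient -/

/-- Exponent vectors `(a, b)` of the monomials in `monomialsA n k d`. -/
def exponents (n k d : ℕ) : Set ((Fin n → ℕ) × (Fin d → ℕ)) :=
  {a | IsSubshuffle d d a} ×ˢ {b | ∀ i : Fin d, b i < k - d + ((i : ℕ) + 1)}

/-- The monomial `x^a y^b`. -/
def xyMonomial (n k d : ℕ) (e : (Fin n → ℕ) × (Fin d → ℕ)) : PolyXYT n k d :=
  (∏ j, X (ix j) ^ e.1 j) * ∏ i, X (iy i) ^ e.2 i

theorem mem_monomialsA_iff {n k d : ℕ} (hd : 0 < d) (m : PolyXYT n k d) :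
    m ∈ monomialsA n k d ↔ ∃ e ∈ exponents n k d, m = xyMonomial n k d e := by
  constructor
  · rintro ⟨a, b, ha, hb, rfl⟩
    exact ⟨(a, b), ⟨(isSubstaircase_iff_isSubshuffle hd a).1 ha, hb⟩, rfl⟩
  · rintro ⟨⟨a, b⟩, ⟨ha, hb⟩, rfl⟩
    exact ⟨a, b, (isSubstaircase_iff_isSubshuffle hd a).2 ha, hb, rfl⟩

theorem finite_exponents (n k d : ℕ) : (exponents n k d).Finite :=
  (finite_setOf_isSubshuffle d d n).prod <|
    (Set.Finite.pi fun i : Fin d => Set.finite_Iio (k - d + ((i : ℕ) + 1))).subset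
      fun _ h i _ => h i

instance (n k d : ℕ) : Fintype (exponents n k d) := (finite_exponents n k d).fintype

theorem card_exponents {n k d : ℕ} (hdk : d ≤ k) : Fintype.card (exponents n k d) =
    k.descFactorial d * (d.factorial * Nat.stirlingSecond n d) := by
  have h : {b : Fin d → ℕ | ∀ i : Fin d, b i < k - d + ((i : ℕ) + 1)} =
      (Fintype.piFinset fun i : Fin d => Finset.range (k - d + ((i : ℕ) + 1)) :
        Finset (Fin d → ℕ)) := by
    ext b
    simp
  rw [← Nat.card_eq_fintype_card, Nat.card_coe_set_eq, exponents, Set.ncard_prod,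
    ncard_isSubshuffle_self, h, Set.ncard_coe_finset, Fintype.card_piFinset, mul_comm]
  congr 1
  simp only [Finset.card_range]
  rw [Fin.prod_univ_eq_prod_range fun i => k - d + (i + 1)]
  have h2 := Nat.add_descFactorial_eq_ascFactorial (k - d) d
  rw [Nat.sub_add_cancel hdk] at h2
  rw [h2, Nat.ascFactorial_eq_prod_range]
  exact Finset.prod_congr rfl fun i _ => by ring

/-- The monomials `x^a y^b` span the quotient by `idealJ` over `ℚ[t]`: the `x`-part is handled over
the subring generated by the `t` and `y`, and the `y`-part over `ℚ[t]`. -/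
theorem span_xyMonomial_eq_top {n k d : ℕ} (hdk : d ≤ k) (hdn : d ≤ n) :
    Submodule.span (MvPolynomial (Fin k) ℚ) (Set.range fun e : exponents n k d =>
      Ideal.Quotient.mk (idealJ n k d) (xyMonomial n k d e)) = ⊤ := by
  set N := Submodule.span (MvPolynomial (Fin k) ℚ) (Set.range fun e : exponents n k d =>
      Ideal.Quotient.mk (idealJ n k d) (xyMonomial n k d e))
  rcases subsingleton_or_nontrivial (PolyXYT n k d ⧸ idealJ n k d) with _ | _
  · exact Subsingleton.elim _ _
  let π := Ideal.Quotient.mk (idealJ n k d)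
  obtain ⟨hT, hX, hP⟩ := (idealJ_le_ker_iff hdk hdn π).1 (Ideal.mk_ker).ge
  let φ := algebraMap (MvPolynomial (Fin k) ℚ) (PolyXYT n k d ⧸ idealJ n k d)
  have hφ : ∀ p, φ p = π (rename it p) := fun _ => rfl
  let y : Fin d → PolyXYT n k d ⧸ idealJ n k d := fun j => π (X (iy j))
  -- the subring generated by the `t` and `y` variables
  let B : Subring (PolyXYT n k d ⧸ idealJ n k d) := Subring.closure (Set.range φ ∪ Set.range y)
  let φB : MvPolynomial (Fin k) ℚ →+* B :=
    φ.codRestrict B fun p => Subring.subset_closure (Or.inl ⟨p, rfl⟩)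
  let yB : Fin d → B := fun j => ⟨y j, Subring.subset_closure (Or.inr ⟨j, rfl⟩)⟩
  let Y : Polynomial B := ∏ j, (.X - .C (yB j))
  have hYm : Y.Monic := Polynomial.monic_prod_X_sub_C _ _
  have hYmap : Y.map B.subtype = ∏ j, (.X - .C (y j)) := by
    simp [Y, yB, Polynomial.map_prod]
  let T : Polynomial (MvPolynomial (Fin k) ℚ) := ∏ i, (.X - .C (X i))
  have hTmap : T.map φ = ∏ i, (.X - .C (π (X (it i)))) := by
    simp [T, Polynomial.map_prod, hφ]
  have hspanY := closure_monomials_flag_eq_top d k φB yB T hdk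
    (Polynomial.monic_prod_X_sub_C _ _)
    (by rw [Polynomial.natDegree_prod_of_monic _ _ fun i _ => Polynomial.monic_X_sub_C _]; simp)
    (by
      rw [← Polynomial.map_dvd_map B.subtype Subtype.val_injective hYm, hYmap, Polynomial.map_map]
      exact hTmap ▸ hT)
    (by
      have hmap : (Subring.closure (Set.range φB ∪ Set.range yB)).map B.subtype = B := by
        rw [RingHom.map_closure, Set.image_union, ← Set.range_comp, ← Set.range_comp]
        rfl
      rw [eq_top_iff]
      rintro s -
      obtain ⟨s', hs', h⟩ := hmap.ge s.2
      rwa [← Subtype.val_injective h])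
  have hspanX := closure_monomials_isSubshuffle_eq_top d n d B.subtype (fun i => π (X (ix i))) Y Y
    hYm (by
      rw [Polynomial.natDegree_prod_of_monic _ _ fun i _ => Polynomial.monic_X_sub_C _]; simp)
    hYm (by
      rw [Polynomial.natDegree_prod_of_monic _ _ fun i _ => Polynomial.monic_X_sub_C _]; simp)
    dvd_rfl
    (fun i => by
      rw [← Polynomial.eval_map, hYmap, Polynomial.eval_prod, ← hP i]
      simp [y])
    (hYmap ▸ hX)
    (by
      rw [eq_top_iff]
      rintro s -
      obtain ⟨p, rfl⟩ := Ideal.Quotient.mk_surjective s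
      induction p using MvPolynomial.induction_on with
      | C q =>
        have : (Ideal.Quotient.mk (idealJ n k d)) (C q) = φ (C q) := by rw [hφ, rename_C]
        rw [this]
        exact Subring.subset_closure (Or.inl ⟨φB (C q), rfl⟩)
      | add p q hp hq => rw [map_add]; exact add_mem hp hq
      | mul_X p v hp =>
        rw [map_mul]
        refine mul_mem hp ?_
        rcases v with i | j | l
        · exact Subring.subset_closure (Or.inr ⟨i, rfl⟩)
        · exact Subring.subset_closure (Or.inl ⟨yB j, rfl⟩)
        · have : (Ideal.Quotient.mk (idealJ n k d)) (X (it l)) = φ (X l) := by rw [hφ, rename_X]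
          rw [this]
          exact Subring.subset_closure (Or.inl ⟨φB (X l), rfl⟩))
  suffices h : (⊤ : AddSubgroup (PolyXYT n k d ⧸ idealJ n k d)) ≤ N.toAddSubgroup from
    eq_top_iff.2 fun s _ => h (AddSubgroup.mem_top s)
  rw [← hspanX, AddSubgroup.closure_le]
  rintro _ ⟨r, a, ha, rfl⟩
  suffices h : (⊤ : AddSubgroup B) ≤ N.toAddSubgroup.comap
      ((AddMonoidHom.mulRight (∏ i, π (X (ix i)) ^ a i)).comp B.subtype.toAddMonoidHom) from
    h (AddSubgroup.mem_top r)
  rw [← hspanY, AddSubgroup.closure_le]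
  rintro _ ⟨c, b, hb, rfl⟩
  have hmem := N.smul_mem c (Submodule.subset_span ⟨⟨(a, b), ha, hb⟩, rfl⟩)
  refine (congrArg (· ∈ N) ?_).mpr hmem
  change φ c * B.subtype (∏ i, yB i ^ b i) * _ = φ c * π (xyMonomial n k d (a, b))
  simp [xyMonomial, yB, y]
  ring

/-! ### Components of the locus -/

/-- The irreducible components of the locus: pairs of an injection `f` with `y_i = t_{f(i)}` and a
surjection `g` with `x_j = y_{g(j)}`. -/
abbrev Component (n k d : ℕ) : Type :=
  (Fin d ↪ Fin k) × {g : Fin n → Fin d // Function.Surjective g}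

theorem card_component (n k d : ℕ) : Fintype.card (Component n k d) =
    k.descFactorial d * (d.factorial * Nat.stirlingSecond n d) := by
  rw [Fintype.card_prod, Fintype.card_embedding_eq, card_surjective, Fintype.card_fin,
    Fintype.card_fin]

/-- The index of the `t`-variable to which a coordinate is equal on a component. -/
def Component.pos {n k d : ℕ} (c : Component n k d) : Idx n k d → Fin k :=
  Sum.elim (fun j => c.1 (c.2.1 j)) (Sum.elim c.1 id)

/-- Restriction of polynomials to a component, which is parametrized by its `t`-coordinates. -/
def restrict {n k d : ℕ} (c : Component n k d) :
    PolyXYT n k d →ₐ[MvPolynomial (Fin k) ℚ] MvPolynomial (Fin k) ℚ :=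
  { (rename c.pos : PolyXYT n k d →ₐ[ℚ] MvPolynomial (Fin k) ℚ) with
    commutes' := fun p => by
      change rename c.pos (rename it p) = p
      rw [rename_rename]
      exact rename_id_apply p }

theorem restrict_apply {n k d : ℕ} (c : Component n k d) (p : PolyXYT n k d) :
    restrict c p = rename c.pos p := rfl

theorem idealJ_le_ker_restrict {n k d : ℕ} (hdk : d ≤ k) (hdn : d ≤ n) (c : Component n k d) :
    idealJ n k d ≤ RingHom.ker (restrict c : PolyXYT n k d →+* MvPolynomial (Fin k) ℚ) := by
  rw [idealJ_le_ker_iff hdk hdn]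
  refine ⟨prod_X_sub_C_dvd_of_injective c.1 c.1.injective fun j => ?_,
    prod_X_sub_C_dvd_of_injective (Function.surjInv c.2.2) (Function.injective_surjInv _)
      fun j => ?_, fun i => Finset.prod_eq_zero (Finset.mem_univ (c.2.1 i)) ?_⟩
  · simp [restrict_apply, Component.pos]
  · simp [restrict_apply, Component.pos, Function.surjInv_eq]
  · simp [restrict_apply, Component.pos]

theorem mem_locus_iff {n k d : ℕ} (z : Idx n k d → ℚ) :
    z ∈ locus n k d ↔ ∃ (c : Component n k d) (t : Fin k → ℚ), z = t ∘ c.pos := by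
  constructor
  · rintro ⟨⟨f, hf, hy⟩, g, hg, hx⟩
    refine ⟨(⟨f, hf⟩, ⟨g, hg⟩), fun i => z (it i), ?_⟩
    funext v
    rcases v with j | i | l
    · simpa [Component.pos, hy] using hx j
    · simpa [Component.pos] using hy i
    · rfl
  · rintro ⟨c, t, rfl⟩
    exact ⟨⟨c.1, c.1.injective, fun _ => rfl⟩, c.2.1, c.2.2, fun _ => rfl⟩

theorem mem_vanishingIdeal_locus_iff {n k d : ℕ} (p : PolyXYT n k d) :
    p ∈ vanishingIdeal ℚ (locus n k d) ↔ ∀ c : Component n k d, restrict c p = 0 := by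
  rw [mem_vanishingIdeal_iff]
  constructor
  · intro h c
    refine MvPolynomial.funext fun t => ?_
    rw [restrict_apply, eval_rename, map_zero]
    exact h _ ((mem_locus_iff _).2 ⟨c, t, rfl⟩)
  · intro h z hz
    obtain ⟨c, t, rfl⟩ := (mem_locus_iff z).1 hz
    have := h c
    rw [restrict_apply] at this
    rw [← aeval_rename, this, map_zero]

theorem exists_restrict_separating {n k d : ℕ} {c c' : Component n k d} (h : c ≠ c') :
    ∃ p : PolyXYT n k d, restrict c p ≠ 0 ∧ restrict c' p = 0 := by
  have hpos : ∃ v, c.pos v ≠ c'.pos v := by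
    by_contra! hall
    have h1 : c.1 = c'.1 := DFunLike.ext _ _ fun i => hall (iy i)
    refine h (Prod.ext h1 (Subtype.ext (funext fun j => c.1.injective ?_)))
    conv_rhs => rw [h1]
    exact hall (ix j)
  obtain ⟨v, hv⟩ := hpos
  refine ⟨X v - X (it (c'.pos v)), ?_, ?_⟩
  · have h1 : restrict c (X v - X (it (c'.pos v))) = X (c.pos v) - X (c'.pos v) := by
      simp [restrict_apply, Component.pos]
    rw [h1, sub_ne_zero]
    exact fun h => hv (X_injective h)
  · simp [restrict_apply, Component.pos]

/-- Lagrange interpolation on the set of components. -/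
theorem exists_restrict_eq_zero_of_ne {n k d : ℕ} (c : Component n k d) :
    ∃ p : PolyXYT n k d, restrict c p ≠ 0 ∧ ∀ c' ≠ c, restrict c' p = 0 := by
  classical
  have h : ∀ c' : Component n k d, ∃ p : PolyXYT n k d,
      restrict c p ≠ 0 ∧ (c' ≠ c → restrict c' p = 0) := fun c' => by
    by_cases hc : c' = c
    · exact ⟨1, by simp, fun h => absurd hc h⟩
    · obtain ⟨p, hp, hp'⟩ := exists_restrict_separating (Ne.symm hc)
      exact ⟨p, hp, fun _ => hp'⟩
  choose F hF hF' using h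
  refine ⟨∏ c', F c', ?_, fun c' hc' => ?_⟩
  · rw [map_prod]
    exact Finset.prod_ne_zero_iff.2 fun c' _ => hF c'
  · rw [map_prod]
    exact Finset.prod_eq_zero (Finset.mem_univ c') (hF' c' hc')

/-! ### Linear independence and the vanishing ideal -/

/-- Simultaneous restriction to all components, with values in the fraction field of `ℚ[t]`. -/
def restrictAll {n k d : ℕ} (hdk : d ≤ k) (hdn : d ≤ n) :
    (PolyXYT n k d ⧸ idealJ n k d) →ₗ[MvPolynomial (Fin k) ℚ]
      (Component n k d → FractionRing (MvPolynomial (Fin k) ℚ)) :=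
  LinearMap.pi fun c => (Algebra.linearMap (MvPolynomial (Fin k) ℚ) _).comp
    (Ideal.Quotient.liftₐ (idealJ n k d) (restrict c)
      fun _ hp => idealJ_le_ker_restrict hdk hdn c hp).toLinearMap

theorem restrictAll_mk {n k d : ℕ} (hdk : d ≤ k) (hdn : d ≤ n) (p : PolyXYT n k d)
    (c : Component n k d) : restrictAll hdk hdn (Ideal.Quotient.mk _ p) c =
      algebraMap _ (FractionRing (MvPolynomial (Fin k) ℚ)) (restrict c p) := rfl

theorem span_restrictAll_eq_top {n k d : ℕ} (hdk : d ≤ k) (hdn : d ≤ n) :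
    Submodule.span (FractionRing (MvPolynomial (Fin k) ℚ))
      (Set.range fun e : exponents n k d =>
        restrictAll hdk hdn (Ideal.Quotient.mk (idealJ n k d) (xyMonomial n k d e))) = ⊤ := by
  classical
  set N := Submodule.span (FractionRing (MvPolynomial (Fin k) ℚ))
      (Set.range fun e : exponents n k d =>
        restrictAll hdk hdn (Ideal.Quotient.mk (idealJ n k d) (xyMonomial n k d e)))
  have hmem : ∀ s, restrictAll hdk hdn s ∈ N := by
    intro s
    have hs : s ∈ Submodule.span (MvPolynomial (Fin k) ℚ) (Set.range fun e : exponents n k d =>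
      Ideal.Quotient.mk (idealJ n k d) (xyMonomial n k d e)) :=
        span_xyMonomial_eq_top hdk hdn ▸ Submodule.mem_top
    refine Submodule.span_le (p := (N.restrictScalars (MvPolynomial (Fin k) ℚ)).comap
      (restrictAll hdk hdn)) |>.2 ?_ hs
    rintro _ ⟨e, rfl⟩
    exact Submodule.subset_span ⟨e, rfl⟩
  have hsingle : ∀ c : Component n k d,
      (Pi.single c 1 : Component n k d → FractionRing (MvPolynomial (Fin k) ℚ)) ∈ N := by
    intro c
    obtain ⟨p, hp, hp'⟩ := exists_restrict_eq_zero_of_ne c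
    have hne : algebraMap _ (FractionRing (MvPolynomial (Fin k) ℚ)) (restrict c p) ≠ 0 := by
      simpa using hp
    have h := N.smul_mem (algebraMap _ (FractionRing (MvPolynomial (Fin k) ℚ)) (restrict c p))⁻¹
      (hmem (Ideal.Quotient.mk _ p))
    convert h using 1
    funext c'
    rw [Pi.smul_apply, restrictAll_mk, smul_eq_mul]
    by_cases hc : c' = c
    · subst hc
      rw [Pi.single_eq_same, inv_mul_cancel₀ hne]
    · rw [Pi.single_eq_of_ne hc, hp' c' hc, map_zero, mul_zero]
  rw [eq_top_iff]
  intro w _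
  rw [pi_eq_sum_univ w]
  refine sum_mem fun c _ => N.smul_mem _ ?_
  convert hsingle c using 1
  funext c'
  simp [Pi.single_apply, eq_comm]

/-- The restrictions of the monomials span a vector space whose dimension, the number of
components, is the number of monomials; so they are linearly independent. -/
theorem linearIndependent_restrictAll {n k d : ℕ} (hdk : d ≤ k) (hdn : d ≤ n) :
    LinearIndependent (MvPolynomial (Fin k) ℚ) (fun e : exponents n k d =>
      restrictAll hdk hdn (Ideal.Quotient.mk (idealJ n k d) (xyMonomial n k d e))) := by
  have h := linearIndependent_of_top_le_span_of_card_eq_finrank (span_restrictAll_eq_top hdk hdn).ge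
    (by rw [Module.finrank_fintype_fun_eq_card, card_exponents hdk, card_component])
  refine h.restrict_scalars ?_
  intro p q hpq
  simpa [Algebra.smul_def] using hpq

/-- The monomials `x^a y^b` with exponents in `exponents n k d`, as a basis over `ℚ[t]`. -/
def xyBasis {n k d : ℕ} (hdk : d ≤ k) (hdn : d ≤ n) :
    Module.Basis (exponents n k d) (MvPolynomial (Fin k) ℚ) (PolyXYT n k d ⧸ idealJ n k d) :=
  Module.Basis.mk (LinearIndependent.of_comp _ (linearIndependent_restrictAll hdk hdn))
    (span_xyMonomial_eq_top hdk hdn).ge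

theorem xyBasis_apply {n k d : ℕ} (hdk : d ≤ k) (hdn : d ≤ n) (e : exponents n k d) :
    xyBasis hdk hdn e = Ideal.Quotient.mk (idealJ n k d) (xyMonomial n k d e) := by
  simp [xyBasis]

/-- `restrictAll` maps a `ℚ[t]`-basis to a linearly independent family. -/
theorem restrictAll_injective {n k d : ℕ} (hdk : d ≤ k) (hdn : d ≤ n) :
    Function.Injective (restrictAll hdk hdn : (PolyXYT n k d ⧸ idealJ n k d) →ₗ[_] _) := by
  rw [injective_iff_map_eq_zero]
  intro s hs
  let b := xyBasis hdk hdn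
  have h := linearIndependent_iff.1 (linearIndependent_restrictAll hdk hdn) (b.repr s) (by
    rw [← hs]
    conv_rhs => rw [← b.linearCombination_repr s, Finsupp.apply_linearCombination]
    congr 2
    funext e
    simp [b, xyBasis_apply])
  simpa using h

theorem idealJ_eq_vanishingIdeal {n k d : ℕ} (hdk : d ≤ k) (hdn : d ≤ n) :
    idealJ n k d = vanishingIdeal ℚ (locus n k d) := by
  ext p
  rw [mem_vanishingIdeal_locus_iff]
  constructor
  · exact fun hp c => idealJ_le_ker_restrict hdk hdn c hp
  · intro hp
    rw [← Ideal.Quotient.eq_zero_iff_mem]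
    refine restrictAll_injective hdk hdn ?_
    rw [map_zero]
    funext c
    rw [restrictAll_mk, hp c, map_zero, Pi.zero_apply]

/-- The products of the `ℚ[t]`-basis with the monomials in `t` form a `ℚ`-basis. -/
theorem exists_basis_tAugment {n k d : ℕ} (hd : 0 < d) (hdk : d ≤ k) (hdn : d ≤ n) :
    ∃ b : Module.Basis (tAugment (monomialsA n k d)) ℚ (PolyXYT n k d ⧸ idealJ n k d),
      ∀ p, b p = Ideal.Quotient.mk (idealJ n k d) (p : PolyXYT n k d) := by
  let b := (basisMonomials (Fin k) ℚ).smulTower (xyBasis hdk hdn)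
  let F : (Fin k →₀ ℕ) × exponents n k d → tAugment (monomialsA n k d) := fun q =>
    ⟨xyMonomial n k d q.2 * ∏ i, X (it i) ^ q.1 i, _,
      (mem_monomialsA_iff hd _).2 ⟨q.2, q.2.2, rfl⟩, q.1, rfl⟩
  have hF : ∀ q, b q = Ideal.Quotient.mk (idealJ n k d) (F q : PolyXYT n k d) := by
    rintro ⟨c, e⟩
    rw [Module.Basis.smulTower_apply, xyBasis_apply, coe_basisMonomials]
    dsimp only
    rw [smul_mk, mul_comm, monomial_eq, Finsupp.prod_fintype _ _ fun _ => pow_zero _]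
    simp [F]
  have hbij : Function.Bijective F := by
    refine ⟨fun q q' h => b.injective ?_, ?_⟩
    · rw [hF, hF, h]
    · rintro ⟨_, m, hm, c, rfl⟩
      obtain ⟨e, he, rfl⟩ := (mem_monomialsA_iff hd m).1 hm
      exact ⟨(Finsupp.equivFunOnFinite.symm c, ⟨e, he⟩), rfl⟩
  refine ⟨b.reindex (Equiv.ofBijective F hbij), fun p => ?_⟩
  obtain ⟨q, rfl⟩ := hbij.2 p
  rw [← hF, Module.Basis.reindex_apply]
  congr 1
  exact (Equiv.ofBijective F hbij).symm_apply_apply q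

end Multivariate

end OrbitHarmonics

end

theorem mainTheorem5 (n k d : ℕ) (hd : 0 < d) (hdk : d ≤ k) (hkn : k ≤ n) :
    OrbitHarmonics.idealJ n k d =
        MvPolynomial.vanishingIdeal ℚ (OrbitHarmonics.locus n k d) ∧
      (∃ b : Module.Basis (OrbitHarmonics.tAugment (OrbitHarmonics.monomialsA n k d)) ℚ
          (OrbitHarmonics.PolyXYT n k d ⧸ OrbitHarmonics.idealJ n k d),
        ∀ p, b p = Ideal.Quotient.mk (OrbitHarmonics.idealJ n k d)
          (p : OrbitHarmonics.PolyXYT n k d)) ∧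
      Module.Free (MvPolynomial (Fin k) ℚ)
        (OrbitHarmonics.PolyXYT n k d ⧸ OrbitHarmonics.idealJ n k d) ∧
      Module.Finite (MvPolynomial (Fin k) ℚ)
        (OrbitHarmonics.PolyXYT n k d ⧸ OrbitHarmonics.idealJ n k d) ∧
      (Module.finrank (MvPolynomial (Fin k) ℚ)
          (OrbitHarmonics.PolyXYT n k d ⧸ OrbitHarmonics.idealJ n k d) : ℚ) =
        (k.factorial * d.factorial : ℚ) / ((k - d).factorial : ℚ) * Nat.stirlingSecond n d := by
  have hdn := hdk.trans hkn
  refine ⟨OrbitHarmonics.idealJ_eq_vanishingIdeal hdk hdn,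
    OrbitHarmonics.exists_basis_tAugment hd hdk hdn,
    .of_basis (OrbitHarmonics.xyBasis hdk hdn), .of_basis (OrbitHarmonics.xyBasis hdk hdn), ?_⟩
  rw [Module.finrank_eq_card_basis (OrbitHarmonics.xyBasis hdk hdn),
    OrbitHarmonics.card_exponents hdk, ← Nat.factorial_mul_descFactorial hdk]
  have h : ((k - d).factorial : ℚ) ≠ 0 := Nat.cast_ne_zero.2 (Nat.factorial_ne_zero _)
  push_cast
  field_simp
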